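/- Let $\mathcal A$ be a finite alphabet, let $\mathbf u = u_0u_1u_2\dots$ be an infinite word over $\mathcal A$, and let $\mathcal L(\mathbf u)$ be its language, i.e. the set of all finite factors $u_iu_{i+1}\cdots u_{i+n-1}$ ($i,n\ge 0$), including the empty word. Suppose that $\mathcal L(\mathbf u)$ is closed under reversal: for every $w=w_0\cdots w_{n-1}\in\mathcal L(\mathbf u)$ the reversal $\overline w=w_{n-1}\cdots w_0$ is also in $\mathcal L(\mathbf u)$. A word $w$ is a palindrome if $w=\overline w$. The word $\mathbf u$ is called rich in palindromes if every $w\in\mathcal L(\mathbf u)$ contains, as factors, exactly $|w|+1$ distinct palindromes (including the empty word). For $w\in\mathcal L(\mathbf u)$ put $$\mathrm{Lext}(w)=\{a\in\mathcal A: aw\in\mathcal L(\mathbf u)\},\qquad \mathrm{Rext}(w)=\{b\in\mathcal A: wb\in\mathcal L(\mathbf u)\},$$ $$\mathrm{Bext}(w)=\{awb\in\mathcal L(\mathbf u): a,b\in\mathcal A\},\qquad \mathrm b(w)=\#\mathrm{Bext}(w)-\#\mathrm{Rext}(w)-\#\mathrm{Lext}(w)+1\in\mathbb Z,$$ and, for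 a palindrome $w$, $\mathrm{Pext}(w)=\{awa\in\mathcal L(\mathbf u): a\in\mathcal A\}$. The integer $\mathrm b(w)$ is the bilateral order of $w$. A factor $w$ is bispecial if $\#\mathrm{Lext}(w)\ge 2$ and $\#\mathrm{Rext}(w)\ge 2$. Then $\mathbf u$ is rich in palindromes if and only if every bispecial factor $w$ of $\mathbf u$ satisfies: - if $w$ is not a palindrome, then $\mathrm b(w)=0$; - if $w$ is a palindrome, then $\mathrm b(w)=\#\mathrm{Pext}(w)-1$. -/

import Mathlib

namespace InfWord

/-- The language of the infinite word `u = u 0, u 1, u 2, …`: the set of all its (finite) factors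
`u i, u (i+1), …, u (i+n-1)`, the empty word included (`n = 0`). -/
def language {A : Type*} (u : ℕ → A) : Set (List A) :=
  {w | ∃ i n : ℕ, w = (List.range n).map (fun k => u (i + k))}

/-- The language of `u` contains with every factor its reversal. -/
def ClosedUnderReversal {A : Type*} (u : ℕ → A) : Prop :=
  ∀ w ∈ language u, w.reverse ∈ language u

/-- The set of distinct palindromes, the empty word included, that are factors of the finite
word `w`. -/
def palindromicFactors {A : Type*} (w : List A) : Set (List A) :=
  {p | p <:+: w ∧ p.Palindrome}

/-- `u` is rich in palindromes: every factor `w` of `u` contains exactly `|w| + 1` distinct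
palindromes, the empty word included. -/
def IsRich {A : Type*} (u : ℕ → A) : Prop :=
  ∀ w ∈ language u, (palindromicFactors w).ncard = w.length + 1

/-- Left extensions of `w`: the letters `a` such that `aw` is a factor of `u`. -/
def Lext {A : Type*} (u : ℕ → A) (w : List A) : Set A :=
  {a | [a] ++ w ∈ language u}

/-- Right extensions of `w`: the letters `b` such that `wb` is a factor of `u`. -/
def Rext {A : Type*} (u : ℕ → A) (w : List A) : Set A :=
  {b | w ++ [b] ∈ language u}

/-- Bilateral extensions of `w`: the factors of `u` of the form `awb` with letters `a`, `b`. -/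
def Bext {A : Type*} (u : ℕ → A) (w : List A) : Set (List A) :=
  {v | v ∈ language u ∧ ∃ a b : A, v = [a] ++ w ++ [b]}

/-- Palindromic extensions of a palindrome `w`: the factors of `u` of the form `awa` with a
letter `a`. -/
def Pext {A : Type*} (u : ℕ → A) (w : List A) : Set (List A) :=
  {v | v ∈ language u ∧ ∃ a : A, v = [a] ++ w ++ [a]}

/-- `w` is a bispecial factor of `u`: a factor with at least two left extensions and at least two
right extensions. -/
def IsBispecial {A : Type*} (u : ℕ → A) (w : List A) : Prop :=
  w ∈ language u ∧ 2 ≤ (Lext u w).ncard ∧ 2 ≤ (Rext u w).ncard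

/-- The bilateral order `b(w) = #Bext(w) - #Rext(w) - #Lext(w) + 1`, an integer. -/
noncomputable def bilateralOrder {A : Type*} (u : ℕ → A) (w : List A) : ℤ :=
  ((Bext u w).ncard : ℤ) - ((Rext u w).ncard : ℤ) - ((Lext u w).ncard : ℤ) + 1

end InfWord

/-! Words are taken up to reversal, and both directions rest on one count: a walk sees exactly one
vertex more than it uses non-loop edges precisely when its graph is a tree with loops
(`walk_card_iff`).

If `u` is rich, the stretch between consecutive occurrences of `w` or its reversal is a palindrome
(`IsRich.palindrome_of_return`). So the right extension at one occurrence mirrors the left extension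
at the next, and the occurrences trace a walk whose vertices are classes of one-letter extensions
and whose edges are classes of `Bext`. Palindromic returns of the vertices make it a tree, and the
count (`IsRich.ncard_Bext_classes`) unfolds to the value of `b(w)`.

Conversely, the order condition is automatic for non-bispecial factors. Let C(n) and P(n) count
factors and palindromic factors of length n. Summing `b(w)` over length n gives C(n+2) - 2C(n+1) +
C(n) = P(n+2) - P(n), hence C(n+1) - C(n) + 2 = P(n) + P(n+1) (`ncard_words_succ`). Thus the graph
with classes of length n as vertices and of length n+1 as edges is a tree with loops. This forces
the longest palindromic suffix of every nonempty factor to be new there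
(`exists_palindrome_unioccurrent`), which gives richness. -/

namespace InfWord

/-! ### Walks and trees -/

/-- A walk with vertices `x i` and edges `y i`, whose edges outside `N` are loops, visits exactly
one vertex more than it uses edges of `N` if and only if every edge of `N` leading to a vertex
visited before has been used before. -/
theorem walk_card_iff {V E : Type*} (x : ℕ → V) (y : ℕ → E) (N : Set E)
    (hx : (Set.range x).Finite) (hy : (Set.range y).Finite)
    (h1 : ∀ i j, y i = y j →
      (x i = x j ∧ x (i + 1) = x (j + 1)) ∨ (x i = x (j + 1) ∧ x (i + 1) = x j))
    (h2 : ∀ i, y i ∉ N → x i = x (i + 1)) :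
    (Set.range y ∩ N).ncard + 1 = (Set.range x).ncard ↔
      ∀ i s, y i ∈ N → s ≤ i → x s = x (i + 1) → ∃ j < i, y j = y i := by
  classical
  -- The steps reaching a new vertex. Their edges form a spanning tree, so equality of the counts
  -- says that `N` contributes no other edge.
  set J : Set ℕ := {j | ∀ s ≤ j, x s ≠ x (j + 1)} with hJ
  have injx : Set.InjOn (fun j => x (j + 1)) J := by
    intro i hi j hj hij
    rcases lt_trichotomy i j with h | h | h
    · exact absurd hij (hj (i + 1) h)
    · exact h
    · exact absurd hij.symm (hi (j + 1) h)
  have injy : Set.InjOn y J := by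
    have key : ∀ i ∈ J, ∀ j ∈ J, y i = y j → ¬ i < j := by
      intro i hi j hj hij h
      rcases h1 i j hij with ⟨_, h4⟩ | ⟨h3, _⟩
      · exact hj (i + 1) h h4
      · exact hj i h.le h3
    intro i hi j hj hij
    exact le_antisymm (not_lt.mp (key j hj i hi hij.symm)) (not_lt.mp (key i hi j hj hij))
  have imx : insert (x 0) ((fun j => x (j + 1)) '' J) = Set.range x := by
    apply Set.Subset.antisymm
    · rintro v (rfl | ⟨j, -, rfl⟩) <;> exact ⟨_, rfl⟩
    · rintro v hv
      have hv' : ∃ i, x i = v := hv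
      have hf := Nat.find_spec hv'
      have hm := fun m => Nat.find_min hv' (m := m)
      generalize Nat.find hv' = i at hf hm
      rcases i with _ | i
      · exact Or.inl hf.symm
      · refine Or.inr ⟨i, fun s hs h => hm s (by omega) (h.trans hf), hf⟩
  have hx0 : x 0 ∉ (fun j => x (j + 1)) '' J := by
    rintro ⟨j, hj, h⟩
    exact hj 0 (Nat.zero_le _) h.symm
  have hfin : ((fun j => x (j + 1)) '' J).Finite :=
    hx.subset (by rw [← imx]; exact Set.subset_insert _ _)
  have cardx : (Set.range x).ncard = J.ncard + 1 := by
    rw [← imx, Set.ncard_insert_of_notMem hx0 hfin, injx.ncard_image]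
  have hsub : y '' J ⊆ Set.range y ∩ N := by
    rintro _ ⟨j, hj, rfl⟩
    refine ⟨⟨j, rfl⟩, ?_⟩
    by_contra hN
    exact hj j le_rfl (h2 j hN)
  have hfinN : (Set.range y ∩ N).Finite := hy.subset Set.inter_subset_left
  have cardy : (y '' J).ncard = J.ncard := injy.ncard_image
  rw [cardx, ← cardy]
  constructor
  · intro h
    have heq : y '' J = Set.range y ∩ N :=
      Set.eq_of_subset_of_ncard_le hsub (by omega) hfinN
    intro i s hi hs hxs
    have : y i ∈ y '' J := by rw [heq]; exact ⟨⟨i, rfl⟩, hi⟩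
    obtain ⟨j, hj, hji⟩ := this
    refine ⟨j, ?_, hji⟩
    by_contra hlt
    rcases (not_lt.mp hlt).eq_or_lt with rfl | hlt
    · exact hj s hs hxs
    · rcases h1 j i hji with ⟨_, h4⟩ | ⟨_, h4⟩
      · exact hj (i + 1) hlt h4.symm
      · exact hj i hlt.le h4.symm
  · intro h
    have heq : y '' J = Set.range y ∩ N := by
      refine Set.Subset.antisymm hsub ?_
      rintro e ⟨he, heN⟩
      have he' : ∃ i, y i = e := he
      have hf := Nat.find_spec he'
      have hm := fun m => Nat.find_min he' (m := m)
      generalize Nat.find he' = i at hf hm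
      refine ⟨i, fun s hs hxs => ?_, hf⟩
      obtain ⟨j, hj, hji⟩ := h i s (hf ▸ heN) hs hxs
      exact hm j hj (hji.trans hf)
    rw [heq]

/-! ### Factors and reversal classes -/

/-- The factor of `u` of length `n` at position `i`. -/
def factor {A : Type*} (u : ℕ → A) (i n : ℕ) : List A :=
  (List.range n).map fun k => u (i + k)

/-- The class of a word up to reversal. -/
def revClass {A : Type*} (w : List A) : Sym2 (List A) := s(w, w.reverse)

variable {A : Type*} (u : ℕ → A)

theorem revClass_eq_iff {v w : List A} : revClass v = revClass w ↔ v = w ∨ v = w.reverse := by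
  unfold revClass
  rw [Sym2.eq_iff]
  constructor
  · rintro (⟨h, _⟩ | ⟨h, _⟩) <;> simp [h]
  · rintro (h | h) <;> simp [h]

theorem revClass_reverse (w : List A) : revClass w.reverse = revClass w :=
  revClass_eq_iff.2 (Or.inr rfl)

theorem palindrome_iff {w : List A} : w.Palindrome ↔ w.reverse = w :=
  List.Palindrome.iff_reverse_eq

theorem palindrome_reverse_iff {w : List A} : w.reverse.Palindrome ↔ w.Palindrome := by
  rw [palindrome_iff, palindrome_iff, List.reverse_reverse, eq_comm]

/-- The classes of the words that are not palindromes. -/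
def nonpalClasses (A : Type*) : Set (Sym2 (List A)) := revClass '' {w | ¬ w.Palindrome}

theorem revClass_mem_nonpalClasses {w : List A} :
    revClass w ∈ nonpalClasses A ↔ ¬ w.Palindrome := by
  constructor
  · rintro ⟨v, hv, h⟩
    rcases revClass_eq_iff.1 h with rfl | rfl
    · exact hv
    · simpa [palindrome_reverse_iff] using hv
  · exact fun h => ⟨w, h, rfl⟩

theorem image_revClass_inter_nonpalClasses (S : Set (List A)) :
    revClass '' S ∩ nonpalClasses A = revClass '' {w ∈ S | ¬ w.Palindrome} := by
  ext c
  constructor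
  · rintro ⟨⟨w, hw, rfl⟩, h⟩
    exact ⟨w, ⟨hw, revClass_mem_nonpalClasses.1 h⟩, rfl⟩
  · rintro ⟨w, ⟨hw, h⟩, rfl⟩
    exact ⟨⟨w, hw, rfl⟩, revClass_mem_nonpalClasses.2 h⟩

/-- A finite set of words closed under reversal has, together with its palindromes, twice as many
elements as classes. -/
theorem ncard_add_ncard_palindromes {S : Set (List A)} (hS : S.Finite)
    (hr : ∀ w ∈ S, w.reverse ∈ S) :
    S.ncard + {w ∈ S | w.Palindrome}.ncard = 2 * (revClass '' S).ncard := by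
  classical
  obtain ⟨F, rfl⟩ := hS.exists_finset_coe
  have e1 : {w ∈ (F : Set (List A)) | w.Palindrome} = ((F.filter (·.Palindrome) : Finset _) : Set _) := by
    ext; simp
  rw [e1, ← Finset.coe_image, Set.ncard_coe_finset, Set.ncard_coe_finset, Set.ncard_coe_finset]
  rw [Finset.card_eq_sum_card_fiberwise (f := revClass) (s := F) (t := F.image revClass)
      (fun w hw => Finset.mem_coe.2 (Finset.mem_image_of_mem _ hw)),
    Finset.card_eq_sum_card_fiberwise (f := revClass) (s := F.filter (·.Palindrome))
      (t := F.image revClass)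
      (fun w hw => Finset.mem_coe.2 (Finset.mem_image_of_mem _ (Finset.mem_filter.1 hw).1)),
    ← Finset.sum_add_distrib, mul_comm, ← smul_eq_mul, ← Finset.sum_const]
  refine Finset.sum_congr rfl fun c hc => ?_
  obtain ⟨w, hw, rfl⟩ := Finset.mem_image.1 hc
  have hwr : w.reverse ∈ F := by exact_mod_cast hr w (by exact_mod_cast hw)
  by_cases hp : w.reverse = w
  · have a1 : F.filter (fun v => revClass v = revClass w) = {w} := by
      ext v
      simp only [Finset.mem_filter, revClass_eq_iff, hp, or_self, Finset.mem_singleton]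
      exact ⟨fun h => h.2, fun h => ⟨h ▸ hw, h⟩⟩
    have a2 : (F.filter (·.Palindrome)).filter (fun v => revClass v = revClass w) = {w} := by
      ext v
      simp only [Finset.mem_filter, revClass_eq_iff, hp, or_self, Finset.mem_singleton]
      exact ⟨fun h => h.2, fun h => ⟨⟨h ▸ hw, h ▸ palindrome_iff.2 hp⟩, h⟩⟩
    rw [a1, a2]; simp
  · have a1 : F.filter (fun v => revClass v = revClass w) = {w, w.reverse} := by
      ext v
      simp only [Finset.mem_filter, revClass_eq_iff, Finset.mem_insert, Finset.mem_singleton]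
      refine ⟨fun h => h.2, fun h => ⟨?_, h⟩⟩
      rcases h with rfl | rfl <;> assumption
    have a2 : (F.filter (·.Palindrome)).filter (fun v => revClass v = revClass w) = ∅ := by
      ext v
      simp only [Finset.mem_filter, revClass_eq_iff, Finset.notMem_empty, iff_false, not_and]
      rintro ⟨-, h⟩ (rfl | rfl)
      · exact hp (palindrome_iff.1 h)
      · exact hp (palindrome_iff.1 (palindrome_reverse_iff.1 h))
    rw [a1, a2, Finset.card_pair (Ne.symm hp)]; simp

@[simp] theorem length_factor (i n : ℕ) : (factor u i n).length = n := by simp [factor]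

theorem factor_mem_language (i n : ℕ) : factor u i n ∈ language u := ⟨i, n, rfl⟩

theorem mem_language_iff {w : List A} : w ∈ language u ↔ ∃ i, factor u i w.length = w := by
  constructor
  · rintro ⟨i, n, rfl⟩
    exact ⟨i, by simp [factor]⟩
  · rintro ⟨i, h⟩
    exact h ▸ factor_mem_language u i _

theorem factor_add (i m n : ℕ) : factor u i (m + n) = factor u i m ++ factor u (i + m) n := by
  simp [factor, List.range_add, add_assoc]

theorem factor_one (i : ℕ) : factor u i 1 = [u i] := by simp [factor]

theorem factor_succ (i n : ℕ) : factor u i (n + 1) = factor u i n ++ [u (i + n)] := by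
  rw [factor_add, factor_one]

theorem factor_succ' (i n : ℕ) : factor u i (n + 1) = [u i] ++ factor u (i + 1) n := by
  rw [add_comm, factor_add, factor_one]

theorem factor_eq_iff {i j n : ℕ} :
    factor u i n = factor u j n ↔ ∀ k < n, u (i + k) = u (j + k) := by
  simp [factor]

theorem factor_eq_reverse_iff {i j n : ℕ} :
    factor u i n = (factor u j n).reverse ↔ ∀ k < n, u (i + k) = u (j + (n - 1 - k)) := by
  constructor
  · intro h k hk
    have := congrArg (fun l => l[k]?) h
    simpa [factor, hk, List.getElem?_reverse, show n - 1 - k < n by omega] using this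
  · intro h
    apply List.ext_getElem (by simp)
    intro k hk _
    simp only [length_factor] at hk
    simpa [factor] using h k hk

theorem palindrome_factor_iff {i n : ℕ} :
    (factor u i n).Palindrome ↔ ∀ k < n, u (i + k) = u (i + (n - 1 - k)) := by
  rw [palindrome_iff, eq_comm, factor_eq_reverse_iff]

theorem infix_factor_iff {w : List A} {i n : ℕ} :
    w <:+: factor u i n ↔ ∃ j, i ≤ j ∧ j + w.length ≤ i + n ∧ factor u j w.length = w := by
  constructor
  · rintro ⟨s, t, h⟩
    have hl := congrArg List.length h
    simp only [List.length_append, length_factor] at hl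
    refine ⟨i + s.length, by omega, by omega, ?_⟩
    rw [← hl, factor_add, factor_add] at h
    have h1 := List.append_inj_left h (by simp)
    exact (List.append_inj_right h1 (by simp)).symm
  · rintro ⟨j, h1, h2, h3⟩
    refine ⟨factor u i (j - i), factor u (j + w.length) (i + n - (j + w.length)), ?_⟩
    have e : n = (j - i) + w.length + (i + n - (j + w.length)) := by omega
    conv_rhs => rw [e, factor_add, factor_add]
    rw [show i + (j - i) = j by omega, h3,
      show i + (j - i + w.length) = j + w.length by omega]

/-- Reversal exchanges prefix and suffix, so a class is an undirected edge between the classes of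
its prefix and suffix. Palindromes are the loops. -/
theorem revClass_factor_succ {i j n : ℕ}
    (h : revClass (factor u i (n + 1)) = revClass (factor u j (n + 1))) :
    (revClass (factor u i n) = revClass (factor u j n) ∧
      revClass (factor u (i + 1) n) = revClass (factor u (j + 1) n)) ∨
    (revClass (factor u i n) = revClass (factor u (j + 1) n) ∧
      revClass (factor u (i + 1) n) = revClass (factor u j n)) := by
  rcases revClass_eq_iff.1 h with h | h
  · left
    constructor
    · rw [factor_succ, factor_succ] at h
      rw [List.append_inj_left h (by simp)]
    · rw [factor_succ', factor_succ'] at h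
      rw [List.append_inj_right h (by simp)]
  · right
    constructor
    · rw [factor_succ, factor_succ', List.reverse_append] at h
      rw [List.append_inj_left h (by simp), revClass_reverse]
    · rw [factor_succ', factor_succ, List.reverse_append] at h
      rw [List.append_inj_right h (by simp), revClass_reverse]

theorem revClass_factor_of_palindrome {i n : ℕ} (h : (factor u i (n + 1)).Palindrome) :
    revClass (factor u i n) = revClass (factor u (i + 1) n) := by
  have h := (palindrome_iff.1 h).symm
  nth_rw 1 [factor_succ] at h
  rw [factor_succ', List.reverse_append] at h
  rw [List.append_inj_left h (by simp), revClass_reverse]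

theorem mem_language_of_factor_eq {w : List A} {i n : ℕ} (h : factor u i n = w) : w ∈ language u :=
  h ▸ factor_mem_language u i n

theorem mem_language_of_infix {v w : List A} (hw : w ∈ language u) (h : v <:+: w) :
    v ∈ language u := by
  obtain ⟨i, n, rfl⟩ := hw
  obtain ⟨j, -, -, hj⟩ := (infix_factor_iff u).1 h
  exact mem_language_of_factor_eq u hj

variable {u}

/-- Words with language closed under reversal are recurrent. -/
theorem exists_factor_ge (hu : ClosedUnderReversal u) {w : List A} (hw : w ∈ language u) (N : ℕ) :
    ∃ i, N ≤ i ∧ factor u i w.length = w := by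
  have key : ∀ v ∈ language u, ∃ i, N ≤ i ∧ factor u i v.length = v.reverse := by
    intro v hv
    obtain ⟨i, hi⟩ := (mem_language_iff u).1 hv
    -- The `N` spare letters after `v` come first in the reversed prefix and push the copy of
    -- `v.reverse` to offset `N`.
    obtain ⟨j, hj⟩ := (mem_language_iff u).1 (hu _ (factor_mem_language u 0 (i + v.length + N)))
    refine ⟨j + N, by omega, ?_⟩
    rw [List.length_reverse, length_factor, factor_eq_reverse_iff] at hj
    rw [← hi, length_factor, factor_eq_reverse_iff]
    intro k hk
    have := hj (N + k) (by omega)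
    rw [← add_assoc] at this
    rw [this]
    congr 1
    omega
  obtain ⟨i, h1, h2⟩ := key _ (hu w hw)
  exact ⟨i, h1, by simpa using h2⟩


/-! ### Richness and palindromic returns -/

/-- In a rich word, complete returns to a factor or its reversal are palindromes. -/
theorem IsRich.palindrome_of_return (hr : IsRich u) {s t n : ℕ} (hst : s < t)
    (hc : revClass (factor u s n) = revClass (factor u t n))
    (hno : ∀ j, s < j → j < t → revClass (factor u j n) ≠ revClass (factor u t n)) :
    (factor u s (t - s + n)).Palindrome := by
  obtain ⟨M, hM⟩ : ∃ M, t - s + n = M + 1 := ⟨t - s + n - 1, by omega⟩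
  rw [hM]
  have c1 := hr _ (factor_mem_language u s M)
  have c2 := hr _ (factor_mem_language u s (M + 1))
  rw [length_factor] at c1 c2
  -- The last letter must create a new palindrome, necessarily a suffix.
  obtain ⟨p, ⟨hp1, hp⟩, hp2⟩ : ∃ p ∈ palindromicFactors (factor u s (M + 1)),
      p ∉ palindromicFactors (factor u s M) := by
    by_contra! h
    have := Set.ncard_le_ncard (fun p hp => h p hp)
      (Set.finite_of_ncard_ne_zero (s := palindromicFactors (factor u s M)) (by omega))
    omega
  have hp2 : ¬ p <:+: factor u s M := fun h => hp2 ⟨h, hp⟩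
  rw [infix_factor_iff] at hp1 hp2
  push Not at hp2
  obtain ⟨j, hj1, hj2, hj3⟩ := hp1
  have hj4 : j + p.length = s + M + 1 := by
    by_contra h
    exact hp2 j hj1 (by omega) hj3
  have hpal := hj3 ▸ hp
  rw [palindrome_factor_iff] at hpal
  have hmir : ∀ k, k < p.length → u (j + k) = u (t + n - 1 - k) := fun k hk => by
    rw [hpal k hk]; congr 1; omega
  -- A short `p` lies in the final copy, hence also in the initial one and is not new. A long `p`
  -- reflects the final copy to `j`, which must then be `s`.
  rcases le_or_gt p.length n with hpn | hpn
  · exfalso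
    rcases revClass_eq_iff.1 hc with h | h
    · rw [factor_eq_iff] at h
      refine hp2 (s + (n - p.length)) (by omega) (by omega) ?_
      rw [← hj3, length_factor, factor_eq_iff]
      intro k hk
      rw [add_assoc, h _ (by omega)]
      congr 1; omega
    · rw [factor_eq_reverse_iff] at h
      refine hp2 s le_rfl (by omega) ?_
      rw [← hj3, length_factor, factor_eq_iff]
      intro k hk
      rw [h _ (by omega), hmir k hk]
      congr 1; omega
  · have hjc : revClass (factor u j n) = revClass (factor u t n) := by
      rw [revClass_eq_iff, factor_eq_reverse_iff]
      refine Or.inr fun k hk => ?_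
      rw [hmir k (by omega)]; congr 1; omega
    have hjs : j = s := by
      by_contra hne
      exact hno j (by omega) (by omega) hjc
    subst hjs
    rw [← hj3, show p.length = M + 1 by omega] at hp
    exact hp

/-- The witness is the longest palindromic suffix. From its last earlier occurrence, the text is
compared with the text read backwards from the end; `H` rules out the first mismatch. -/
theorem exists_palindrome_unioccurrent
    (H : ∀ s k i, revClass (factor u s k) = revClass (factor u (s + i + 1) k) →
      ¬ (factor u (s + i) (k + 1)).Palindrome →
      ∃ j < i, revClass (factor u (s + j) (k + 1)) = revClass (factor u (s + i) (k + 1)))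
    (s₀ M : ℕ) :
    ∃ p : List A, p.Palindrome ∧ p <:+: factor u s₀ (M + 1) ∧ ¬ p <:+: factor u s₀ M := by
  classical
  obtain ⟨N, hN⟩ : ∃ N, N = s₀ + M + 1 := ⟨_, rfl⟩
  obtain ⟨m, hm, hpal, hmax⟩ : ∃ m ≤ M + 1, (factor u (N - m) m).Palindrome ∧
      ∀ k, m < k → k ≤ M + 1 → ¬ (factor u (N - k) k).Palindrome := by
    have h0 : (factor u (N - 0) 0).Palindrome := by simp [factor, List.Palindrome.nil]
    exact ⟨_, Nat.findGreatest_le (M + 1),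
      Nat.findGreatest_spec (P := fun m => (factor u (N - m) m).Palindrome) (Nat.zero_le _) h0,
      fun k hk hk' => Nat.findGreatest_is_greatest hk hk'⟩
  refine ⟨_, hpal, (infix_factor_iff u).2 ⟨N - m, by omega, by simp; omega, by simp⟩, ?_⟩
  rw [infix_factor_iff, length_factor]
  rintro ⟨j₀, hj₀⟩
  obtain ⟨s, ⟨hs1, hs2, hs3⟩, hlast⟩ : ∃ s, (s₀ ≤ s ∧ s + m ≤ s₀ + M ∧
      factor u s m = factor u (N - m) m) ∧
      ∀ j, s < j → j + m ≤ s₀ + M → factor u j m ≠ factor u (N - m) m := by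
    have hb : j₀ ≤ s₀ + M := by omega
    have hsp := Nat.findGreatest_spec (P := fun j => s₀ ≤ j ∧ j + m ≤ s₀ + M ∧
      factor u j m = factor u (N - m) m) hb hj₀
    refine ⟨_, hsp, fun j hj hj' h => ?_⟩
    exact Nat.findGreatest_is_greatest hj (by omega) ⟨by omega, hj', h⟩
  have hmir : ∀ c < m, u (N - m + c) = u (N - 1 - c) := fun c hc => by
    rw [(palindrome_factor_iff u).1 hpal c hc]; congr 1; omega
  -- Agreement all the way would make the word from `s` to the end a palindromic suffix longer than
  -- `m`.
  obtain ⟨k, hk1, hk2, hk3, hk4⟩ : ∃ k, m ≤ k ∧ k < N - s ∧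
      factor u s k = (factor u (N - k) k).reverse ∧
      factor u s (k + 1) ≠ (factor u (N - (k + 1)) (k + 1)).reverse := by
    by_contra! h
    have : ∀ k, m ≤ k → k ≤ N - s → factor u s k = (factor u (N - k) k).reverse := by
      intro k hk
      induction k, hk using Nat.le_induction with
      | base => intro _; rw [hs3, palindrome_iff.1 hpal]
      | succ k hk ih => exact fun hk' => h k hk (by omega) (ih (by omega))
    have h2 := this (N - s) (by omega) le_rfl
    refine hmax (N - s) (by omega) (by omega) ?_
    rw [show N - (N - s) = s by omega] at h2 ⊢
    exact palindrome_iff.2 h2.symm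
  have e1 : s + (N - k - 1 - s) = N - (k + 1) := by omega
  have e2 : s + (N - k - 1 - s) + 1 = N - k := by omega
  obtain ⟨j, hj, hjc⟩ := H s k (N - k - 1 - s)
    (by rw [e2, hk3, revClass_reverse])
    (by rw [e1]; exact hmax _ (by omega) (by omega))
  rw [e1] at hjc
  -- An equal copy ends with the palindrome, after `s`. A reversed copy begins with it, so `j = 0`,
  -- against the mismatch `hk4`.
  rcases revClass_eq_iff.1 hjc with h | h
  · rw [factor_eq_iff] at h
    refine hlast (s + j + (k + 1 - m)) (by omega) (by omega) ?_
    rw [factor_eq_iff]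
    intro c hc
    rw [add_assoc, h _ (by omega)]
    congr 1; omega
  · have hj0 : j = 0 := by
      by_contra hne
      refine hlast (s + j) (by omega) (by omega) ?_
      rw [factor_eq_reverse_iff] at h
      rw [factor_eq_iff]
      intro c hc
      rw [h c (by omega), hmir c hc]
      congr 1; omega
    subst hj0
    exact hk4 h

theorem isRich_of_exists_return
    (H : ∀ s k i, revClass (factor u s k) = revClass (factor u (s + i + 1) k) →
      ¬ (factor u (s + i) (k + 1)).Palindrome →
      ∃ j < i, revClass (factor u (s + j) (k + 1)) = revClass (factor u (s + i) (k + 1))) :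
    IsRich u := by
  have main : ∀ i n, (palindromicFactors (factor u i n)).ncard = n + 1 := by
    intro i n
    induction n with
    | zero =>
      have : palindromicFactors (factor u i 0) = {[]} := by
        ext p
        simp only [palindromicFactors, factor, List.range_zero, List.map_nil, List.infix_nil,
          Set.mem_ofPred_eq, Set.mem_singleton_iff, and_iff_left_iff_imp]
        rintro rfl
        exact List.Palindrome.nil
      rw [this, Set.ncard_singleton]
    | succ M ih =>
      obtain ⟨p, hp, hp1, hp2⟩ := exists_palindrome_unioccurrent H i M
      -- New palindromes are suffixes; the shorter of two, reflected in the longer, would be a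
      -- prefix of it and so old.
      have key : ∀ q r : List A, r.Palindrome → q.Palindrome →
          q <:+: factor u i (M + 1) → r <:+: factor u i (M + 1) →
          ¬ q <:+: factor u i M → ¬ r <:+: factor u i M → ¬ q.length < r.length := by
        intro q r hr hq hq1 hr1 hq2 hr2 hlt
        rw [infix_factor_iff] at hq1 hr1 hq2 hr2
        push Not at hq2 hr2
        obtain ⟨a, ha1, ha2, ha3⟩ := hq1
        obtain ⟨b, hb1, hb2, hb3⟩ := hr1
        have ha4 : a + q.length = i + M + 1 := by
          by_contra h; exact hq2 a ha1 (by omega) ha3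
        have hb4 : b + r.length = i + M + 1 := by
          by_contra h; exact hr2 b hb1 (by omega) hb3
        refine hq2 b hb1 (by omega) ?_
        have hq' := ha3 ▸ hq
        have hr' := hb3 ▸ hr
        rw [palindrome_factor_iff] at hq' hr'
        rw [← ha3, length_factor, factor_eq_iff]
        intro c hc
        rw [hr' c (by omega), hq' c hc]
        congr 1; omega
      have hins : palindromicFactors (factor u i (M + 1)) =
          insert p (palindromicFactors (factor u i M)) := by
        apply Set.Subset.antisymm
        · rintro q ⟨hq1, hq⟩
          by_cases hq2 : q <:+: factor u i M
          · exact Or.inr ⟨hq2, hq⟩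
          · left
            have l1 := key q p hp hq hq1 hp1 hq2 hp2
            have l2 := key p q hq hp hp1 hq1 hp2 hq2
            have hl : p.length = q.length := by omega
            rw [infix_factor_iff] at hq1 hp1 hq2 hp2
            push Not at hq2 hp2
            obtain ⟨a, ha1, ha2, ha3⟩ := hq1
            obtain ⟨b, hb1, hb2, hb3⟩ := hp1
            have ha4 : a + q.length = i + M + 1 := by
              by_contra h; exact hq2 a ha1 (by omega) ha3
            have hb4 : b + p.length = i + M + 1 := by
              by_contra h; exact hp2 b hb1 (by omega) hb3
            rw [← ha3, ← hb3, hl, show a = b by omega]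
        · rintro q (rfl | ⟨hq1, hq⟩)
          · exact ⟨hp1, hp⟩
          · refine ⟨hq1.trans ?_, hq⟩
            rw [factor_succ]
            exact (List.prefix_append _ _).isInfix
      rw [hins, Set.ncard_insert_of_notMem (fun h => hp2 h.1)
        (Set.finite_of_ncard_ne_zero (by omega)), ih]
  rintro _ ⟨i, n, rfl⟩
  exact (main i n).trans (by simp)

/-! ### The extension tree of a factor in a rich word -/

/-- The factors of `u` that extend `w` by one letter, to the left or to the right. -/
def oneExt (u : ℕ → A) (w : List A) : Set (List A) :=
  {v | v ∈ language u ∧ ((∃ a, v = [a] ++ w) ∨ ∃ b, v = w ++ [b])}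

theorem finite_of_length [Finite A] {S : Set (List A)} (n : ℕ) (h : ∀ w ∈ S, w.length = n) :
    S.Finite :=
  (List.finite_length_eq A n).subset h

theorem exists_strictMono_enum {p : ℕ → Prop} (hp : ∀ N, ∃ i, N < i ∧ p i) :
    ∃ t : ℕ → ℕ, StrictMono t ∧ (∀ k, p (t k)) ∧ ∀ i, p i → ∃ k, t k = i := by
  classical
  have hf : {i | p i}.Infinite := Set.infinite_of_forall_exists_gt fun N => by
    obtain ⟨i, h1, h2⟩ := hp N
    exact ⟨i, h2, h1⟩
  exact ⟨Nat.nth p, Nat.nth_strictMono hf, fun k => Nat.nth_mem_of_infinite hf k,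
    fun i hi => ⟨Nat.count p i, Nat.nth_count hi⟩⟩

/-- In a rich word, the extensions of a factor form a tree up to reversal. -/
theorem IsRich.ncard_Bext_classes [Finite A] (hr : IsRich u) (hu : ClosedUnderReversal u)
    {w : List A} (hw : w ∈ language u) :
    (revClass '' {v ∈ Bext u w | ¬ v.Palindrome}).ncard + 1 =
      (revClass '' oneExt u w).ncard := by
  obtain ⟨n, hn⟩ : ∃ n, w.length = n := ⟨_, rfl⟩
  -- Position 0 is skipped so that every occurrence has a letter before it and `t k - 1` is not
  -- truncated.
  obtain ⟨t, tmono, ht, tsurj⟩ := exists_strictMono_enum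
    (p := fun i => 1 ≤ i ∧ revClass (factor u i n) = revClass w) (fun N => by
      obtain ⟨i, h1, h2⟩ := exists_factor_ge hu hw (N + 1)
      exact ⟨i, h1, by omega, by rw [← hn, h2]⟩)
  have tpos : ∀ k, t k - 1 + 1 = t k := fun k => Nat.sub_add_cancel (ht k).1
  set x : ℕ → Sym2 (List A) := fun k => revClass (factor u (t k - 1) (n + 1)) with hx
  set y : ℕ → Sym2 (List A) := fun k => revClass (factor u (t k - 1) (n + 2)) with hy
  have xsucc : ∀ k, x (k + 1) = revClass (factor u (t k) (n + 1)) := by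
    intro k
    have hlt := tmono (Nat.lt_succ_self k)
    have hp := hr.palindrome_of_return hlt ((ht k).2.trans (ht (k + 1)).2.symm)
      (fun j h1 h2 h3 => by
        obtain ⟨m, rfl⟩ := tsurj j ⟨by omega, h3.trans (ht (k + 1)).2⟩
        have := tmono.lt_iff_lt.1 h1
        have := tmono.lt_iff_lt.1 h2
        omega)
    rw [palindrome_factor_iff] at hp
    simp only [hx]
    rw [revClass_eq_iff, factor_eq_reverse_iff]
    right
    intro c hc
    have := hp (t (k + 1) - 1 - t k + c) (by simp only [Nat.succ_eq_add_one] at *; omega)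
    simp only [Nat.succ_eq_add_one] at *
    rw [show t (k + 1) - 1 + c = t k + (t (k + 1) - 1 - t k + c) by omega, this]
    congr 1; omega
  have rx : Set.range x = revClass '' oneExt u w := by
    apply Set.Subset.antisymm
    · rintro _ ⟨k, rfl⟩
      have e := factor_succ' u (t k - 1) n
      rw [tpos] at e
      rcases revClass_eq_iff.1 (ht k).2 with h | h
      · exact ⟨_, ⟨factor_mem_language u _ _, Or.inl ⟨_, by rw [e, h]⟩⟩, rfl⟩
      · refine ⟨_, ⟨hu _ (factor_mem_language u (t k - 1) (n + 1)), Or.inr ⟨u (t k - 1), ?_⟩⟩,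
          revClass_reverse _⟩
        rw [e, h]; simp
    -- A right extension of `w` is, up to reversal, a left extension of `w.reverse`, so left
    -- extensions suffice.
    · have aux : ∀ a w', [a] ++ w' ∈ language u → w'.length = n → revClass w' = revClass w →
          revClass ([a] ++ w') ∈ Set.range x := by
        intro a w' h1 hl h2
        obtain ⟨i, hi⟩ := (mem_language_iff u).1 h1
        have hi' : factor u i (n + 1) = [a] ++ w' := by
          rw [← hi]; simp [hl]
        have hi2 := hi'
        rw [factor_succ'] at hi2
        have hi3 := List.append_inj_right hi2 (by simp)
        obtain ⟨k, hk⟩ := tsurj (i + 1) ⟨by omega, by rw [hi3, h2]⟩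
        refine ⟨k, ?_⟩
        simp only [hx, hk, Nat.add_sub_cancel]
        rw [hi']
      rintro _ ⟨v, ⟨hv, ⟨a, rfl⟩ | ⟨b, rfl⟩⟩, rfl⟩
      · exact aux a w hv hn rfl
      · have := hu _ hv
        rw [← revClass_reverse]
        rw [List.reverse_append] at this ⊢
        exact aux b w.reverse this (by simpa using hn) (revClass_reverse w)
  have ry : Set.range y = revClass '' Bext u w := by
    apply Set.Subset.antisymm
    · rintro _ ⟨k, rfl⟩
      have e : factor u (t k - 1) (n + 2) = [u (t k - 1)] ++ factor u (t k) n ++ [u (t k + n)] := by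
        rw [factor_succ, factor_succ', tpos, show t k - 1 + (n + 1) = t k + n by
          have := tpos k; omega]
      rcases revClass_eq_iff.1 (ht k).2 with h | h
      · exact ⟨_, ⟨factor_mem_language u _ _, _, _, by rw [e, h]⟩, rfl⟩
      · refine ⟨_, ⟨hu _ (factor_mem_language u (t k - 1) (n + 2)), u (t k + n), u (t k - 1), ?_⟩,
          revClass_reverse _⟩
        rw [e, h]; simp
    · rintro _ ⟨v, ⟨hv, a, b, rfl⟩, rfl⟩
      obtain ⟨i, hi⟩ := (mem_language_iff u).1 hv
      have hi' : factor u i (n + 2) = [a] ++ w ++ [b] := by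
        rw [← hi]; simp [hn]
      have hi2 := hi'
      rw [factor_succ, factor_succ'] at hi2
      have hi3 := List.append_inj_right (List.append_inj_left hi2 (by simp [hn])) (by simp)
      obtain ⟨k, hk⟩ := tsurj (i + 1) ⟨by omega, by rw [hi3]⟩
      refine ⟨k, ?_⟩
      simp only [hy, hk, Nat.add_sub_cancel]
      rw [hi']
  rw [← image_revClass_inter_nonpalClasses, ← ry, ← rx]
  refine (walk_card_iff x y (nonpalClasses A) ?_ ?_ ?_ ?_).2 ?_
  · rw [rx]
    refine (finite_of_length (n + 1) ?_).image _
    rintro _ ⟨-, ⟨a, rfl⟩ | ⟨b, rfl⟩⟩ <;> simp [hn]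
  · rw [ry]
    refine (finite_of_length (n + 2) ?_).image _
    rintro _ ⟨-, a, b, rfl⟩
    simp [hn]
  · intro i j hij
    have := revClass_factor_succ u hij
    rw [tpos, tpos] at this
    rwa [xsucc, xsucc]
  · intro i hi
    rw [revClass_mem_nonpalClasses, not_not] at hi
    have := revClass_factor_of_palindrome u hi
    rwa [tpos, ← xsucc] at this
  · intro k s hk hs hxs
    rw [revClass_mem_nonpalClasses] at hk
    rw [xsucc] at hxs
    classical
    -- The return of the vertex from its last visit `τ` is a palindrome; its prefix of length `n +
    -- 2` is the reversed edge `y k`, used before.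
    obtain ⟨τ, ⟨h1, h2, h3⟩, hlast⟩ : ∃ τ, (t 0 - 1 ≤ τ ∧ τ < t k ∧
        revClass (factor u τ (n + 1)) = revClass (factor u (t k) (n + 1))) ∧
        ∀ j, τ < j → j < t k →
          revClass (factor u j (n + 1)) ≠ revClass (factor u (t k) (n + 1)) := by
      have m1 := tmono.monotone hs
      have m0 := tmono.monotone (Nat.zero_le s)
      have p0 := tpos s
      have hsp := Nat.findGreatest_spec (P := fun j => t 0 - 1 ≤ j ∧ j < t k ∧
        revClass (factor u j (n + 1)) = revClass (factor u (t k) (n + 1)))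
        (show t s - 1 ≤ t k by omega) ⟨by omega, by omega, hxs⟩
      refine ⟨_, hsp, fun j hj hj' h => ?_⟩
      exact Nat.findGreatest_is_greatest hj (by omega) ⟨by omega, hj', h⟩
    have hp := hr.palindrome_of_return h2 h3 hlast
    have hrev : factor u τ (n + 2) = (factor u (t k - 1) (n + 2)).reverse := by
      rw [palindrome_factor_iff] at hp
      rw [factor_eq_reverse_iff]
      intro c hc
      rw [hp c (by omega)]
      have := tpos k
      congr 1; omega
    have hyτ : revClass (factor u τ (n + 2)) = y k := by rw [hrev, revClass_reverse]
    have hτ : revClass (factor u (τ + 1) n) = revClass w := by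
      rw [← (ht k).2, revClass_eq_iff, factor_eq_reverse_iff]
      rw [factor_eq_reverse_iff] at hrev
      refine Or.inr fun c hc => ?_
      rw [add_assoc, hrev (1 + c) (by omega)]
      have := tpos k
      congr 1; omega
    obtain ⟨j, hj⟩ := tsurj (τ + 1) ⟨by omega, hτ⟩
    have hτj : t j - 1 = τ := by omega
    refine ⟨j, ?_, by rw [← hyτ, ← hτj]⟩
    have hjk : j ≤ k := tmono.le_iff_le.1 (by omega)
    -- For `j = k` the edge would be its own reversal, against `hk`.
    refine lt_of_le_of_ne hjk ?_
    rintro rfl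
    rw [hτj] at hrev
    exact hk (by rw [hτj]; exact palindrome_iff.2 hrev.symm)


/-! ### From class counts to bilateral orders -/

/-- The condition on the bilateral order of a factor that characterizes richness. -/
def HasRichOrder (u : ℕ → A) (w : List A) : Prop :=
  (¬ w.Palindrome → bilateralOrder u w = 0) ∧
    (w.Palindrome → bilateralOrder u w = ((Pext u w).ncard : ℤ) - 1)

theorem cons_injective (w : List A) : Function.Injective fun a => [a] ++ w := fun a b h => by
  simpa using h

theorem concat_injective (w : List A) : Function.Injective fun a => w ++ [a] := fun a b h => by
  simpa using h

theorem eq_of_perm_cons {a b : A} {v w : List A} (h : [a] ++ v = w) (hp : w.Perm (b :: v)) :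
    a = b := by
  have h2 : (a :: v).Perm (b :: v) := by rw [← h] at hp; exact hp
  have := h2.subset
  classical
  by_contra hne
  have hc := h2.count_eq a
  rw [List.count_cons_self, List.count_cons_of_ne (Ne.symm hne)] at hc
  omega

theorem eq_replicate_of_cons_eq_concat {a b : A} {w : List A} (h : [a] ++ w = w ++ [b]) :
    w = List.replicate w.length a := by
  induction w with
  | nil => rfl
  | cons c w ih =>
    simp only [List.cons_append, List.cons.injEq] at h
    obtain ⟨rfl, h⟩ := h
    have := ih h
    rw [List.length_cons, List.replicate_succ, ← this]

theorem palindrome_of_cons_eq_concat {a b : A} {w : List A} (h : [a] ++ w = w ++ [b]) :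
    w.Palindrome := by
  rw [palindrome_iff, eq_replicate_of_cons_eq_concat h, List.reverse_replicate]

theorem reverse_sandwich (a b : A) (w : List A) :
    ([a] ++ w ++ [b]).reverse = [b] ++ w.reverse ++ [a] := by simp

theorem sandwich_inj {a b a' b' : A} {v w : List A} :
    [a] ++ v ++ [b] = [a'] ++ w ++ [b'] ↔ a = a' ∧ v = w ∧ b = b' := by
  constructor
  · intro h
    simp only [List.cons_append, List.cons.injEq] at h
    obtain ⟨h1, h2⟩ := List.append_inj' h.2 rfl
    exact ⟨h.1, h1, by simpa using h2⟩
  · rintro ⟨rfl, rfl, rfl⟩; rfl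

theorem palindrome_sandwich_iff {a b : A} {w : List A} :
    ([a] ++ w ++ [b]).Palindrome ↔ a = b ∧ w.Palindrome := by
  rw [palindrome_iff, reverse_sandwich, sandwich_inj, palindrome_iff]
  constructor
  · rintro ⟨h1, h2, -⟩; exact ⟨h1.symm, h2⟩
  · rintro ⟨rfl, h⟩; exact ⟨rfl, h, rfl⟩

theorem oneExt_eq (w : List A) :
    oneExt u w = (fun a => [a] ++ w) '' Lext u w ∪ (fun b => w ++ [b]) '' Rext u w := by
  ext v
  constructor
  · rintro ⟨hv, ⟨a, rfl⟩ | ⟨b, rfl⟩⟩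
    · exact Or.inl ⟨a, hv, rfl⟩
    · exact Or.inr ⟨b, hv, rfl⟩
  · rintro (⟨a, ha, rfl⟩ | ⟨b, hb, rfl⟩)
    · exact ⟨ha, Or.inl ⟨a, rfl⟩⟩
    · exact ⟨hb, Or.inr ⟨b, rfl⟩⟩

theorem Bext_finite [Finite A] (w : List A) : (Bext u w).Finite :=
  finite_of_length (w.length + 2) (by rintro _ ⟨-, a, b, rfl⟩; simp)

/-- No two extensions are identified: `aw` and the reversal of `bw` differ in letter counts unless
`a = b`, and any coincidence of a left with a right extension would make `w` a palindrome. -/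
theorem ncard_oneExt_classes_of_not_palindrome [Finite A] {w : List A} (hw : ¬ w.Palindrome) :
    (revClass '' oneExt u w).ncard = (Lext u w).ncard + (Rext u w).ncard := by
  have hne : w ≠ w.reverse := fun h => hw (palindrome_iff.2 h.symm)
  have inj : Set.InjOn revClass (oneExt u w) := by
    rintro v ⟨-, hv⟩ v' ⟨-, hv'⟩ h
    rcases revClass_eq_iff.1 h with h | h
    · exact h
    · rcases hv with ⟨a, rfl⟩ | ⟨a, rfl⟩ <;> rcases hv' with ⟨b, rfl⟩ | ⟨b, rfl⟩
      · rw [eq_of_perm_cons h (List.reverse_perm _)]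
      · rw [List.reverse_append] at h
        exact absurd (List.append_inj_right h rfl) hne
      · rw [List.reverse_append] at h
        exact absurd (List.append_inj_left h (by simp)) hne
      · have h' := congrArg List.reverse h
        rw [List.reverse_append, List.reverse_reverse] at h'
        have := eq_of_perm_cons h' ((List.perm_append_comm.trans
          ((List.reverse_perm w).symm.cons b)))
        rw [this]
  rw [inj.ncard_image, oneExt_eq, Set.ncard_union_eq ?_ (Set.toFinite _ |>.image _)
    (Set.toFinite _ |>.image _), Set.ncard_image_of_injective _ (cons_injective w),
    Set.ncard_image_of_injective _ (concat_injective w)]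
  rw [Set.disjoint_left]
  rintro _ ⟨a, -, rfl⟩ ⟨b, -, h⟩
  exact hw (palindrome_of_cons_eq_concat h.symm)

theorem Lext_eq_Rext (hu : ClosedUnderReversal u) {w : List A} (hw : w.Palindrome) :
    Lext u w = Rext u w := by
  rw [palindrome_iff] at hw
  ext a
  constructor
  · intro h
    have := hu _ h
    rwa [List.reverse_append, hw] at this
  · intro h
    have := hu _ h
    rwa [List.reverse_append, hw] at this

/-- Here `wa` is the reversal of `aw`, so each letter contributes one class. -/
theorem ncard_oneExt_classes_of_palindrome (hu : ClosedUnderReversal u) {w : List A}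
    (hw : w.Palindrome) : (revClass '' oneExt u w).ncard = (Lext u w).ncard := by
  have hw' := palindrome_iff.1 hw
  have e : revClass '' oneExt u w = (fun a => revClass ([a] ++ w)) '' Lext u w := by
    rw [oneExt_eq, Set.image_union, Set.image_image, Set.image_image, ← Lext_eq_Rext hu hw,
      Set.union_eq_left]
    rintro _ ⟨a, ha, rfl⟩
    refine ⟨a, ha, ?_⟩
    refine revClass_eq_iff.2 (Or.inr ?_)
    rw [List.reverse_append, hw']
    rfl
  rw [e]
  refine Set.ncard_image_of_injective _ fun a b h => ?_
  rcases revClass_eq_iff.1 h with h | h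
  · exact cons_injective w h
  · exact eq_of_perm_cons h (List.reverse_perm _)

theorem Pext_eq {w : List A} (hw : w.Palindrome) :
    Pext u w = {v ∈ Bext u w | v.Palindrome} := by
  ext v
  constructor
  · rintro ⟨hv, a, rfl⟩
    exact ⟨⟨hv, a, a, rfl⟩, palindrome_sandwich_iff.2 ⟨rfl, hw⟩⟩
  · rintro ⟨⟨hv, a, b, rfl⟩, h⟩
    obtain ⟨rfl, -⟩ := palindrome_sandwich_iff.1 h
    exact ⟨hv, a, rfl⟩

theorem ncard_sep_add_ncard_sep_not {S : Set (List A)} (hS : S.Finite) (p : List A → Prop) :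
    {v ∈ S | p v}.ncard + {v ∈ S | ¬ p v}.ncard = S.ncard := by
  rw [← Set.ncard_union_eq _ (hS.subset (Set.sep_subset _ _)) (hS.subset (Set.sep_subset _ _))]
  · congr 1
    ext v
    by_cases h : p v <;> simp [h]
  · rw [Set.disjoint_left]
    rintro v ⟨-, h⟩ ⟨-, h'⟩
    exact h' h

theorem ncard_nonpalindromes {S : Set (List A)} (hS : S.Finite)
    (hr : ∀ w ∈ S, w.reverse ∈ S) :
    {v ∈ S | ¬ v.Palindrome}.ncard =
      2 * (revClass '' {v ∈ S | ¬ v.Palindrome}).ncard := by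
  have key := ncard_add_ncard_palindromes (S := {v ∈ S | ¬ v.Palindrome})
    (hS.subset (Set.sep_subset _ _))
    (fun w hw => ⟨hr w hw.1, fun h => hw.2 (palindrome_reverse_iff.1 h)⟩)
  have : {w ∈ {v ∈ S | ¬ v.Palindrome} | w.Palindrome} = ∅ := by
    ext w
    exact ⟨fun h => h.1.2 h.2, fun h => h.elim⟩
  rwa [this, Set.ncard_empty, add_zero] at key

theorem IsRich.hasRichOrder [Finite A] (hr : IsRich u) (hu : ClosedUnderReversal u) {w : List A}
    (hw : w ∈ language u) : HasRichOrder u w := by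
  have h := hr.ncard_Bext_classes hu hw
  refine ⟨fun hp => ?_, fun hp => ?_⟩
  · rw [ncard_oneExt_classes_of_not_palindrome hp] at h
    have e : {v ∈ Bext u w | ¬ v.Palindrome} = Bext u w := by
      refine Set.Subset.antisymm (Set.sep_subset _ _) ?_
      rintro _ ⟨hv, a, b, rfl⟩
      exact ⟨⟨hv, a, b, rfl⟩, fun h => hp (palindrome_sandwich_iff.1 h).2⟩
    have inj : Set.InjOn revClass (Bext u w) := by
      rintro _ ⟨-, a, b, rfl⟩ _ ⟨-, a', b', rfl⟩ h
      rcases revClass_eq_iff.1 h with h | h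
      · exact h
      · rw [reverse_sandwich, sandwich_inj] at h
        exact absurd (palindrome_iff.2 h.2.1.symm) hp
    rw [e, inj.ncard_image] at h
    rw [bilateralOrder]
    omega
  · rw [ncard_oneExt_classes_of_palindrome hu hp] at h
    have h1 := ncard_sep_add_ncard_sep_not (Bext_finite (u := u) w) (·.Palindrome)
    have h2 := ncard_nonpalindromes (Bext_finite (u := u) w) (by
      rintro _ ⟨hv, a, b, rfl⟩
      refine ⟨hu _ hv, b, a, ?_⟩
      rw [reverse_sandwich, palindrome_iff.1 hp])
    rw [← Pext_eq hp] at h1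
    rw [bilateralOrder, ← Lext_eq_Rext hu hp]
    omega

/-! ### Factors that are not bispecial -/

theorem exists_Rext_of_mem {w : List A} (hw : w ∈ language u) : ∃ b, w ++ [b] ∈ language u := by
  obtain ⟨i, hi⟩ := (mem_language_iff u).1 hw
  refine ⟨u (i + w.length), ?_⟩
  have := factor_mem_language u i (w.length + 1)
  rwa [factor_succ, hi] at this

theorem exists_Lext_of_mem (hu : ClosedUnderReversal u) {w : List A} (hw : w ∈ language u) :
    ∃ a, [a] ++ w ∈ language u := by
  obtain ⟨a, ha⟩ := exists_Rext_of_mem (hu _ hw)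
  exact ⟨a, by simpa using hu _ ha⟩

theorem ncard_Bext_of_Rext_eq (u : ℕ → A) {w : List A} {b : A} (h : Rext u w = {b}) :
    (Bext u w).ncard = (Lext u w).ncard := by
  have : Bext u w = (fun a => [a] ++ w ++ [b]) '' Lext u w := by
    apply Set.Subset.antisymm
    · rintro _ ⟨hv, a, c, rfl⟩
      have hc : c ∈ Rext u w := mem_language_of_infix u hv
        ⟨[a], [], by simp⟩
      rw [h] at hc
      obtain rfl : c = b := hc
      exact ⟨a, mem_language_of_infix u hv (List.prefix_append _ _).isInfix, rfl⟩
    · rintro _ ⟨a, ha, rfl⟩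
      obtain ⟨c, hc⟩ := exists_Rext_of_mem ha
      have hc' : c ∈ Rext u w := mem_language_of_infix u hc ⟨[a], [], by simp⟩
      rw [h] at hc'
      obtain rfl : c = b := hc'
      exact ⟨hc, a, c, rfl⟩
  rw [this]
  exact Set.ncard_image_of_injective _ fun a a' h => (sandwich_inj.1 h).1

theorem ncard_Bext_of_Lext_eq (hu : ClosedUnderReversal u) {w : List A} {a : A}
    (h : Lext u w = {a}) : (Bext u w).ncard = (Rext u w).ncard := by
  have : Bext u w = (fun b => [a] ++ w ++ [b]) '' Rext u w := by
    apply Set.Subset.antisymm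
    · rintro _ ⟨hv, c, b, rfl⟩
      have hc : c ∈ Lext u w := mem_language_of_infix u hv (List.prefix_append _ _).isInfix
      rw [h] at hc
      obtain rfl : c = a := hc
      exact ⟨b, mem_language_of_infix u hv ⟨[c], [], by simp⟩, rfl⟩
    · rintro _ ⟨b, hb, rfl⟩
      obtain ⟨c, hc⟩ := exists_Lext_of_mem hu hb
      rw [← List.append_assoc] at hc
      have hc' : c ∈ Lext u w := mem_language_of_infix u hc (List.prefix_append _ _).isInfix
      rw [h] at hc'
      obtain rfl : c = a := hc'
      exact ⟨hc, c, b, rfl⟩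
  rw [this]
  exact Set.ncard_image_of_injective _ fun a a' h => (sandwich_inj.1 h).2.2

/-- A unique extension on one side gives `b(w) = 0`; if `w` is a palindrome, its only letter on
either side is the same one, so `Pext` has one element. -/
theorem hasRichOrder_of_not_isBispecial [Finite A] (hu : ClosedUnderReversal u) {w : List A}
    (hw : w ∈ language u) (hb : ¬ IsBispecial u w) : HasRichOrder u w := by
  have hL : (Lext u w).ncard ≠ 0 := by
    rw [Ne, Set.ncard_eq_zero (Set.toFinite _), ← Ne, ← Set.nonempty_iff_ne_empty]
    exact exists_Lext_of_mem hu hw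
  have hR : (Rext u w).ncard ≠ 0 := by
    rw [Ne, Set.ncard_eq_zero (Set.toFinite _), ← Ne, ← Set.nonempty_iff_ne_empty]
    exact exists_Rext_of_mem hw
  have h0 : bilateralOrder u w = 0 := by
    by_cases hR1 : (Rext u w).ncard = 1
    · obtain ⟨b, hb⟩ := Set.ncard_eq_one.1 hR1
      rw [bilateralOrder, ncard_Bext_of_Rext_eq u hb, hR1]
      omega
    · have hL1 : (Lext u w).ncard = 1 := by
        by_contra hL1
        exact hb ⟨hw, by omega, by omega⟩
      obtain ⟨a, ha⟩ := Set.ncard_eq_one.1 hL1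
      rw [bilateralOrder, ncard_Bext_of_Lext_eq hu ha, hL1]
      omega
  refine ⟨fun _ => h0, fun hp => ?_⟩
  have e := Lext_eq_Rext hu hp
  have hR1 : (Rext u w).ncard = 1 := by
    by_contra hR1
    exact hb ⟨hw, by rw [e]; omega, by omega⟩
  obtain ⟨b, hb⟩ := Set.ncard_eq_one.1 hR1
  have hP : Pext u w = Bext u w := by
    apply Set.Subset.antisymm
    · rintro _ ⟨hv, a, rfl⟩
      exact ⟨hv, a, a, rfl⟩
    · rintro _ ⟨hv, a, c, rfl⟩
      have ha : a ∈ Lext u w := mem_language_of_infix u hv (List.prefix_append _ _).isInfix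
      have hc : c ∈ Rext u w := mem_language_of_infix u hv ⟨[a], [], by simp⟩
      rw [e, hb] at ha
      rw [hb] at hc
      obtain rfl : a = b := ha
      obtain rfl : c = a := hc
      exact ⟨hv, c, rfl⟩
  rw [h0, hP, ncard_Bext_of_Rext_eq u hb, e, hR1]
  rfl

/-! ### Factor and palindrome counts by length -/

/-- The factors of length `n`. -/
def words (u : ℕ → A) (n : ℕ) : Set (List A) := {w | w ∈ language u ∧ w.length = n}

/-- The palindromic factors of length `n`. -/
def palindromes (u : ℕ → A) (n : ℕ) : Set (List A) := {w ∈ words u n | w.Palindrome}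

theorem words_finite [Finite A] (u : ℕ → A) (n : ℕ) : (words u n).Finite :=
  finite_of_length n fun _ h => h.2

theorem palindromes_finite [Finite A] (u : ℕ → A) (n : ℕ) : (palindromes u n).Finite :=
  (words_finite u n).subset (Set.sep_subset _ _)

theorem ncard_eq_sum_fiber {S T : Set (List A)} (hS : S.Finite) (hT : T.Finite)
    {f : List A → List A} (hf : ∀ v ∈ S, f v ∈ T) :
    S.ncard = ∑ w ∈ hT.toFinset, {v ∈ S | f v = w}.ncard := by
  classical
  obtain ⟨F, rfl⟩ := hS.exists_finset_coe
  rw [Set.ncard_coe_finset, Finset.card_eq_sum_card_fiberwise (f := f) (t := hT.toFinset)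
    (fun v hv => by simpa using hf v hv)]
  refine Finset.sum_congr rfl fun w _ => ?_
  rw [← Set.ncard_coe_finset]
  congr 1
  ext v; simp

theorem exists_sandwich {v : List A} {n : ℕ} (h : v.length = n + 2) :
    ∃ a w b, v = [a] ++ w ++ [b] ∧ w.length = n := by
  obtain ⟨a, v, rfl⟩ := List.exists_cons_of_length_eq_add_one h
  have hv : v ≠ [] := by rintro rfl; simp at h
  obtain ⟨w, b, rfl⟩ := List.eq_nil_or_concat'  v |>.resolve_left hv
  exact ⟨a, w, b, by simp, by simpa using h⟩

theorem ncard_words_eq_sum_Lext [Finite A] (u : ℕ → A) (n : ℕ) :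
    (words u (n + 1)).ncard = ∑ w ∈ (words_finite u n).toFinset, (Lext u w).ncard := by
  rw [ncard_eq_sum_fiber (words_finite u _) (words_finite u n) (f := List.tail)]
  · refine Finset.sum_congr rfl fun w hw => ?_
    have hw : w ∈ words u n := by simpa using hw
    rw [← Set.ncard_image_of_injective _ (cons_injective w)]
    congr 1
    ext v
    constructor
    · rintro ⟨⟨h1, h2⟩, rfl⟩
      obtain ⟨a, v, rfl⟩ := List.exists_cons_of_length_eq_add_one h2
      exact ⟨a, h1, rfl⟩
    · rintro ⟨a, ha, rfl⟩
      exact ⟨⟨ha, by simp [hw.2]⟩, rfl⟩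
  · rintro v ⟨h1, h2⟩
    exact ⟨mem_language_of_infix u h1 (List.tail_suffix v).isInfix, by simp [h2]⟩

theorem ncard_words_eq_sum_Rext [Finite A] (u : ℕ → A) (n : ℕ) :
    (words u (n + 1)).ncard = ∑ w ∈ (words_finite u n).toFinset, (Rext u w).ncard := by
  rw [ncard_eq_sum_fiber (words_finite u _) (words_finite u n) (f := List.dropLast)]
  · refine Finset.sum_congr rfl fun w hw => ?_
    have hw : w ∈ words u n := by simpa using hw
    rw [← Set.ncard_image_of_injective _ (concat_injective w)]
    congr 1
    ext v
    constructor
    · rintro ⟨⟨h1, h2⟩, rfl⟩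
      have hv : v ≠ [] := by rintro rfl; simp at h2
      have e := List.dropLast_append_getLast hv
      exact ⟨v.getLast hv, by rwa [Rext, Set.mem_ofPred_eq, e], e⟩
    · rintro ⟨a, ha, rfl⟩
      exact ⟨⟨ha, by simp [hw.2]⟩, by simp⟩
  · rintro v ⟨h1, h2⟩
    exact ⟨mem_language_of_infix u h1 (List.dropLast_prefix v).isInfix, by simp [h2]⟩

theorem ncard_words_eq_sum_Bext [Finite A] (u : ℕ → A) (n : ℕ) :
    (words u (n + 2)).ncard = ∑ w ∈ (words_finite u n).toFinset, (Bext u w).ncard := by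
  rw [ncard_eq_sum_fiber (words_finite u _) (words_finite u n) (f := fun v => v.tail.dropLast)]
  · refine Finset.sum_congr rfl fun w hw => ?_
    have hw : w ∈ words u n := by simpa using hw
    congr 1
    ext v
    constructor
    · rintro ⟨⟨h1, h2⟩, rfl⟩
      obtain ⟨a, w, b, rfl, -⟩ := exists_sandwich h2
      exact ⟨h1, a, b, by simp⟩
    · rintro ⟨hv, a, b, rfl⟩
      exact ⟨⟨hv, by simp [hw.2]⟩, by simp⟩
  · rintro v ⟨h1, h2⟩
    obtain ⟨a, w, b, rfl, h⟩ := exists_sandwich h2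
    exact ⟨mem_language_of_infix u h1 ⟨[a], [b], by simp⟩, by simp [h]⟩

theorem ncard_palindromes_eq_sum_Pext [Finite A] (u : ℕ → A) (n : ℕ) :
    (palindromes u (n + 2)).ncard =
      ∑ w ∈ (palindromes_finite u n).toFinset, (Pext u w).ncard := by
  rw [ncard_eq_sum_fiber (palindromes_finite u _) (palindromes_finite u n)
    (f := fun v => v.tail.dropLast)]
  · refine Finset.sum_congr rfl fun w hw => ?_
    have hw : w ∈ palindromes u n := by simpa using hw
    congr 1
    ext v
    constructor
    · rintro ⟨⟨⟨h1, h2⟩, h3⟩, rfl⟩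
      obtain ⟨a, w, b, rfl, -⟩ := exists_sandwich h2
      obtain ⟨rfl, -⟩ := palindrome_sandwich_iff.1 h3
      exact ⟨h1, a, by simp⟩
    · rintro ⟨hv, a, rfl⟩
      exact ⟨⟨⟨hv, by simp [hw.1.2]⟩, palindrome_sandwich_iff.2 ⟨rfl, hw.2⟩⟩, by simp⟩
  · rintro v ⟨⟨h1, h2⟩, h3⟩
    obtain ⟨a, w, b, rfl, h⟩ := exists_sandwich h2
    have e : ([a] ++ w ++ [b]).tail.dropLast = w := by simp
    refine ⟨⟨mem_language_of_infix u h1 ⟨[a], [b], by rw [e]⟩, by rw [e, h]⟩, ?_⟩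
    rw [e]
    exact (palindrome_sandwich_iff.1 h3).2

theorem ncard_words_succ_succ [Finite A] (H : ∀ w ∈ language u, HasRichOrder u w) (n : ℕ) :
    ((words u (n + 2)).ncard : ℤ) - 2 * (words u (n + 1)).ncard + (words u n).ncard =
      (palindromes u (n + 2)).ncard - (palindromes u n).ncard := by
  classical
  have h1 : ∑ w ∈ (words_finite u n).toFinset, bilateralOrder u w =
      ((words u (n + 2)).ncard : ℤ) - 2 * (words u (n + 1)).ncard + (words u n).ncard := by
    simp only [bilateralOrder, Finset.sum_add_distrib, Finset.sum_sub_distrib]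
    have eL := ncard_words_eq_sum_Lext u n
    have eR := ncard_words_eq_sum_Rext u n
    have eB := ncard_words_eq_sum_Bext u n
    have e1 := Set.ncard_eq_toFinset_card _ (words_finite u n)
    zify at eL eR eB e1
    rw [← eL, ← eR, ← eB, Finset.sum_const, nsmul_eq_mul, mul_one, ← e1]
    ring
  have h2 : ∑ w ∈ (words_finite u n).toFinset, bilateralOrder u w =
      ∑ w ∈ (palindromes_finite u n).toFinset, (((Pext u w).ncard : ℤ) - 1) := by
    have e : (palindromes_finite u n).toFinset =
        (words_finite u n).toFinset.filter (·.Palindrome) := by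
      ext w; simp [palindromes]
    rw [e, Finset.sum_filter]
    refine Finset.sum_congr rfl fun w hw => ?_
    have hw : w ∈ words u n := by simpa using hw
    split_ifs with hp
    · exact (H w hw.1).2 hp
    · exact (H w hw.1).1 hp
  rw [← h1, h2, Finset.sum_sub_distrib, ncard_palindromes_eq_sum_Pext,
    Set.ncard_eq_toFinset_card _ (palindromes_finite u n)]
  push_cast
  simp

theorem palindrome_of_length_le_one {w : List A} (h : w.length ≤ 1) : w.Palindrome := by
  match w, h with
  | [], _ => exact List.Palindrome.nil
  | [a], _ => exact List.Palindrome.singleton a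

theorem palindromes_eq_words (u : ℕ → A) {n : ℕ} (hn : n ≤ 1) : palindromes u n = words u n :=
  Set.Subset.antisymm (Set.sep_subset _ _) fun _ h =>
    ⟨h, palindrome_of_length_le_one (h.2.le.trans hn)⟩

/-- The second-difference identity telescopes; the 2 comes from the empty word, both a factor and a
palindrome. -/
theorem ncard_words_succ [Finite A] (H : ∀ w ∈ language u, HasRichOrder u w) (n : ℕ) :
    (words u (n + 1)).ncard + 2 =
      (words u n).ncard + (palindromes u n).ncard + (palindromes u (n + 1)).ncard := by
  induction n with
  | zero =>
    have h0 : words u 0 = {[]} := by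
      ext w
      constructor
      · rintro ⟨-, h⟩
        exact List.length_eq_zero_iff.1 h
      · rintro rfl
        exact ⟨factor_mem_language u 0 0, rfl⟩
    rw [palindromes_eq_words u (Nat.zero_le 1), palindromes_eq_words u le_rfl, h0,
      Set.ncard_singleton, zero_add]
    omega
  | succ n ih =>
    have := ncard_words_succ_succ H n
    rw [show n + 1 + 1 = n + 2 from rfl]
    omega

/-! ### From the counts back to richness -/

theorem range_revClass_factor (hu : ClosedUnderReversal u) (s n : ℕ) :
    (Set.range fun j => revClass (factor u (s + j) n)) = revClass '' words u n := by
  apply Set.Subset.antisymm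
  · rintro _ ⟨j, rfl⟩
    exact ⟨_, ⟨factor_mem_language u _ _, length_factor u _ _⟩, rfl⟩
  · rintro _ ⟨w, ⟨hw, rfl⟩, rfl⟩
    obtain ⟨i, hi, h⟩ := exists_factor_ge hu hw s
    refine ⟨i - s, ?_⟩
    simp only [Nat.add_sub_cancel' hi, h]

theorem isRich_of_hasRichOrder [Finite A] (hu : ClosedUnderReversal u)
    (H : ∀ w ∈ language u, HasRichOrder u w) : IsRich u := by
  refine isRich_of_exists_return fun s k i hc hp => ?_
  have hrev : ∀ n, ∀ w ∈ words u n, w.reverse ∈ words u n := fun n w hw =>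
    ⟨hu w hw.1, by rw [List.length_reverse, hw.2]⟩
  have hT := ncard_words_succ H k
  have h1 := ncard_sep_add_ncard_sep_not (words_finite u (k + 1)) (·.Palindrome)
  have h2 := ncard_nonpalindromes (words_finite u (k + 1)) (hrev _)
  have h3 := ncard_add_ncard_palindromes (words_finite u k) (hrev _)
  -- Half of `ncard_words_succ`: non-palindromic classes have two elements, palindromic ones one.
  have hcard : (revClass '' {v ∈ words u (k + 1) | ¬ v.Palindrome}).ncard + 1 =
      (revClass '' words u k).ncard := by
    simp only [palindromes] at hT
    omega
  rw [← image_revClass_inter_nonpalClasses, ← range_revClass_factor hu s,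
    ← range_revClass_factor hu s] at hcard
  refine (walk_card_iff _ _ _ ?_ ?_ ?_ ?_).1 hcard i 0 (revClass_mem_nonpalClasses.2 hp)
    (Nat.zero_le _) hc
  · rw [range_revClass_factor hu]
    exact (words_finite u _).image _
  · rw [range_revClass_factor hu]
    exact (words_finite u _).image _
  · exact fun i j h => revClass_factor_succ u h
  · intro i hi
    rw [revClass_mem_nonpalClasses, not_not] at hi
    exact revClass_factor_of_palindrome u hi

end InfWord

theorem mainTheorem1 {A : Type*} [Finite A] (u : ℕ → A) (hu : InfWord.ClosedUnderReversal u) :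
    InfWord.IsRich u ↔
      ∀ w : List A, InfWord.IsBispecial u w →
        (¬ w.Palindrome → InfWord.bilateralOrder u w = 0) ∧
        (w.Palindrome →
          InfWord.bilateralOrder u w = ((InfWord.Pext u w).ncard : ℤ) - 1) := by
  refine ⟨fun hr w hw => hr.hasRichOrder hu hw.1, fun H => ?_⟩
  refine InfWord.isRich_of_hasRichOrder hu fun w hw => ?_
  by_cases hb : InfWord.IsBispecial u w
  · exact H w hb
  · exact InfWord.hasRichOrder_of_not_isBispecial hu hw hb
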